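/- All logarithms are to base $2$. A ternary point is an $x\in\{0,u,1\}^N$, a resolution of $x$ is a Boolean point obtained by replacing every $u$ in $x$ by $0$ or $1$, and gates act on $\{0,u,1\}$ by Kleene's three-valued logic. Formulas are trees of gates $\wedge,\vee$ (fan-in $2$) and $\neg$ whose leaves are input variables; the depth of a formula is the maximal number of $\wedge,\vee$ gates on a path from a leaf to the root (not counting negations; the lower bounds below then hold a fortiori if negations are counted). A formula is monotone if it has no $\neg$ gate. A formula $F$ is hazard-free if there is no ternary point $x$ at which $F(x)=u$ although $F$ takes the same Boolean value at all resolutions of $x$. For a Boolean function $f$ let $\mathrm{depth}_F^u(f)$ and $\mathrm{depth}_F^+(f)$ be the minimal depth of a hazard-free, respectively monotone, formula computing $f$. The hazard-derivative of $f$ at a Boolean point $x$ is the Boolean function $y\mapsto \mathrm{d}f(x;y)$ with $\mathrm{d}f(x;y)=1$ iff $f$ is not constant on the resolutions of the point obtained from $x$ by replacing $x_i$ by $u$ for all $i$ with $y_i=1$. Let $\mathrm{mux}_m:\{0,1\}^{m+2^m}\to\{0,1\}$, $\mathrm{mux}_m(s,x)=x_{s}$, be the multiplexer, where the data bits are indexed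 by $s\in\{0,1\}^m$. Let $MC_{k,n}:\{0,1\}^{n^2}\to\{0,1\}$ be the set covering function: its input is the edge set of a bipartite graph on $U\cup V$, $|U|=|V|=n$, and its value is $1$ iff there is $U'\subseteq U$ with $|U'|=k$ such that every $v\in V$ has a neighbour in $U'$. Let $(f\diamond g)(X)=f(g(X_1),\dots,g(X_N))$, where $X_1,\dots,X_N$ are the rows of $X$. **Proposition.** There are absolute constants $c_0,a,C>0$ such that for every real $c\in(0,c_0]$, all $n$ for which $k:=\lfloor c\log n\rfloor$ is at least $1$, and all $m\ge 0$, the following hold. 1. $\mathrm{depth}_F^u(MC_{k,n}\diamond \mathrm{mux}_m)$ is finite and $$\mathrm{depth}_F^u(MC_{k,n}\diamond \mathrm{mux}_m)\ \ge\ \log(3^m)+\log\binom{n}{k}\ \ge\ \log(3)\cdot m+a\,c(\log n)^2 .$$ 2. If $m\ge C\log n$, this bound breaks the monotone barrier, that is, it is stronger than every bound given by a hazard-derivative: for every Boolean point $x$, $$\mathrm{depth}_F^+\bigl(\mathrm{d}(MC_{k,n}\diamond \mathrm{mux}_m)(x;\cdot)\bigr)\ <\ \log(3^m)+\log\binom{n}{k}.$$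 -/

import Mathlib

namespace HazardFree

/-- Kleene's three values: `some false` is `0`, `some true` is `1`, `none` is the unstable value
`u`. -/
abbrev Ternary : Type := Option Bool

/-- Kleene conjunction. -/
def kAnd : Ternary → Ternary → Ternary
  | some false, _ => some false
  | _, some false => some false
  | some true, some true => some true
  | _, _ => none

/-- Kleene disjunction. -/
def kOr : Ternary → Ternary → Ternary
  | some true, _ => some true
  | _, some true => some true
  | some false, some false => some false
  | _, _ => none

/-- Kleene negation. -/
def kNot : Ternary → Ternary
  | some b => some (!b)
  | none => none

/-- A Boolean point, seen as a ternary point all of whose coordinates are stable. -/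
def stable {ι : Type} (y : ι → Bool) : ι → Ternary := fun i => some (y i)

/-- `y` is a resolution of `x`: it agrees with `x` on every stable coordinate of `x`. -/
def IsResolution {ι : Type} (x : ι → Ternary) (y : ι → Bool) : Prop :=
  ∀ i, x i = none ∨ x i = some (y i)

open Classical in
/-- The hazard-free extension of a Boolean function. -/
noncomputable def extension {ι : Type} (f : (ι → Bool) → Bool) (x : ι → Ternary) : Ternary :=
  if ∀ y, IsResolution x y → f y = false then some false
  else if ∀ y, IsResolution x y → f y = true then some true
  else none

/-- The point `x + u y`: the coordinates of `x` where `y` is `1` are made unstable. -/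
def perturb {ι : Type} (x y : ι → Bool) : ι → Ternary :=
  fun i => if y i = true then none else some (x i)

/-- The hazard-derivative `y ↦ df(x; y)` of the Boolean function `f` at the Boolean point `x`:
it is `1` exactly when the hazard-free extension of `f` is unstable at `x + u y`. -/
noncomputable def hazardDerivative {ι : Type} (f : (ι → Bool) → Bool) (x : ι → Bool) :
    (ι → Bool) → Bool :=
  fun y => decide (extension f (perturb x y) = none)

/-- De Morgan formulas whose leaves are labelled by input variables from `ι`. -/
inductive Formula (ι : Type) : Type
  | var : ι → Formula ι
  | neg : Formula ι → Formula ι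
  | and : Formula ι → Formula ι → Formula ι
  | or : Formula ι → Formula ι → Formula ι

namespace Formula

variable {ι : Type}

/-- Evaluation of a formula in Kleene's logic. -/
def eval : Formula ι → (ι → Ternary) → Ternary
  | var i, x => x i
  | neg F, x => kNot (F.eval x)
  | and F G, x => kAnd (F.eval x) (G.eval x)
  | or F G, x => kOr (F.eval x) (G.eval x)

/-- The depth of a formula: the largest number of fan-in two gates on a path from a leaf to the
root. Negations are not counted, as in the identification of formula depth with the communication
complexity of Karchmer-Wigderson games; a lower bound on this depth is also one on the depth in
which negations are counted. -/
def depth : Formula ι → ℕ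
  | var _ => 0
  | neg F => F.depth
  | and F G => max F.depth G.depth + 1
  | or F G => max F.depth G.depth + 1

/-- A formula is monotone if it has no negation gate. -/
def IsMonotone : Formula ι → Prop
  | var _ => True
  | neg _ => False
  | and F G => F.IsMonotone ∧ G.IsMonotone
  | or F G => F.IsMonotone ∧ G.IsMonotone

/-- The formula computes the Boolean function `f`. -/
def Computes (F : Formula ι) (f : (ι → Bool) → Bool) : Prop :=
  ∀ y, F.eval (stable y) = some (f y)

/-- The formula has a hazard at `x`: it is unstable at `x`, but takes one and the same Boolean
value at all the resolutions of `x`. -/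
def HasHazardAt (F : Formula ι) (x : ι → Ternary) : Prop :=
  F.eval x = none ∧ ∃ b : Bool, ∀ y, IsResolution x y → F.eval (stable y) = some b

/-- A formula is hazard-free if it has no hazard. -/
def IsHazardFree (F : Formula ι) : Prop :=
  ∀ x, ¬ F.HasHazardAt x

end Formula

/-- The least depth of a hazard-free formula computing `f` (`⊤` if there is none). -/
noncomputable def hazardFreeDepth {ι : Type} (f : (ι → Bool) → Bool) : ℕ∞ :=
  ⨅ F ∈ {F : Formula ι | F.Computes f ∧ F.IsHazardFree}, (F.depth : ℕ∞)

/-- The least depth of a monotone formula computing `f` (`⊤` if there is none). -/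
noncomputable def monotoneDepth {ι : Type} (f : (ι → Bool) → Bool) : ℕ∞ :=
  ⨅ F ∈ {F : Formula ι | F.Computes f ∧ F.IsMonotone}, (F.depth : ℕ∞)

/-- Block composition: the input is a matrix with rows indexed by `ι`, the inner function is
applied to every row. -/
def blockComp {ι κ : Type} (f : (ι → Bool) → Bool) (g : (κ → Bool) → Bool) :
    (ι × κ → Bool) → Bool :=
  fun X => f (fun i => g (fun j => X (i, j)))

/-- The multiplexer with `m` address bits (left summand) and `2 ^ m` data bits (right summand).
The data bits are indexed by the binary addresses themselves. -/
def mux (m : ℕ) : (Fin m ⊕ (Fin m → Bool) → Bool) → Bool :=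
  fun z => z (Sum.inr (fun i => z (Sum.inl i)))

open Classical in
/-- The set covering function: the input is the edge set `E` of a bipartite graph on two copies of
`Fin n`, and the value is `1` iff some `k` vertices of the first copy have among their neighbours
every vertex of the second copy. -/
noncomputable def setCovering (k n : ℕ) : (Fin n × Fin n → Bool) → Bool :=
  fun E => decide (∃ S : Finset (Fin n), S.card = k ∧ ∀ v, ∃ u ∈ S, E (u, v) = true)

end HazardFree

/-!
A hazard-free formula for `f` takes the value `extension f x` at every ternary point `x`, so it
solves a Karchmer-Wigderson game between the ternary points of value `1` and those of value `0`:
from a point of each kind it leads to a coordinate at which the two points are stable and different.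
If, for each coordinate and each of its two values, a matrix indexed by such pairs is constant on
the pairs that can be separated in this way, then its rank is at most `2 ^ depth`, because rank is
subadditive.

For the composition of `setCovering k n` with `mux m`, all rows get one and the same ternary
address, and the only stable data bits are the selectable ones in the rows of a certificate of
`setCovering k n`. Two different addresses are separated at an address bit unless they are
compatible, and a data bit separates compatible addresses only. Hence the Kronecker product of the
disjointness matrix of the `k`-sets with the compatibility matrix of the addresses qualifies, as
soon as an edge common to a positive certificate of `A` and a negative one of `B` decides whether
`A` and `B` are disjoint; a random bipartite graph with isolated neighbours provides such
certificates. Both factors are invertible, the second one being a tensor power of an invertible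
`3 × 3` matrix, so the rank is `n.choose k * 3 ^ m`.

Hazard derivatives obey a chain rule for block compositions. A derivative of `mux m` is a
disjunction over the `2 ^ m` addresses of conjunctions of at most `m + 1` variables, hence has
monotone depth about `m + logb 2 m`, which is far below `logb 2 3 * m`. A derivative of the monotone
function `setCovering k n` costs only `logb 2 (n.choose k)` plus a term of order `logb 2 n`.
-/

namespace HazardFree

/-! ### Kleene logic -/

lemma kAnd_eq_true : ∀ {a b : Ternary}, kAnd a b = some true ↔ a = some true ∧ b = some true := by
  decide

lemma kAnd_eq_false :
    ∀ {a b : Ternary}, kAnd a b = some false ↔ a = some false ∨ b = some false := by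
  decide

lemma kNot_eq_some : ∀ {a : Ternary} {b : Bool}, kNot a = some b ↔ a = some (!b) := by
  decide

lemma kOr_eq_kNot_kAnd : ∀ a b : Ternary, kOr a b = kNot (kAnd (kNot a) (kNot b)) := by
  decide

/-- Two Kleene values are compatible if some Boolean value resolves both. -/
def Compatible (a b : Ternary) : Prop := a = none ∨ b = none ∨ a = b

instance : DecidableRel Compatible := fun a b =>
  inferInstanceAs (Decidable (a = none ∨ b = none ∨ a = b))

lemma not_compatible_iff :
    ∀ {a b : Ternary}, ¬Compatible a b ↔ ∃ c, a = some c ∧ b = some (!c) := by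
  decide

section Resolutions

variable {ι : Type} {x z : ι → Ternary}

lemma exists_common_resolution_iff :
    (∃ y, IsResolution x y ∧ IsResolution z y) ↔ ∀ i, Compatible (x i) (z i) := by
  have pointwise : ∀ a b : Ternary,
      Compatible a b ↔ ∃ c, (a = none ∨ a = some c) ∧ (b = none ∨ b = some c) := by decide
  simp only [pointwise, Classical.skolem, IsResolution, forall_and]

lemma exists_isResolution (x : ι → Ternary) : ∃ y, IsResolution x y := by
  obtain ⟨y, hy, -⟩ := exists_common_resolution_iff.2 fun i => show Compatible (x i) (x i) from
    .inr (.inr rfl)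
  exact ⟨y, hy⟩

lemma isResolution_stable {y w : ι → Bool} : IsResolution (stable y) w ↔ w = y := by
  simp [IsResolution, stable, funext_iff, eq_comm]

lemma extension_eq_some {f : (ι → Bool) → Bool} {b : Bool} :
    extension f x = some b ↔ ∀ y, IsResolution x y → f y = b := by
  obtain ⟨y, hy⟩ := exists_isResolution x
  unfold extension
  split_ifs with h0 h1
  · refine ⟨fun h w hw => by simpa [h0 w hw] using h, fun h => ?_⟩
    rw [← h y hy, h0 y hy]
  · refine ⟨fun h w hw => by simpa [h1 w hw] using h, fun h => ?_⟩
    rw [← h y hy, h1 y hy]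
  · cases b <;> simp [h0, h1]

lemma extension_stable (f : (ι → Bool) → Bool) (y : ι → Bool) :
    extension f (stable y) = some (f y) :=
  extension_eq_some.2 fun w hw => by rw [isResolution_stable.1 hw]

end Resolutions

namespace Formula

variable {ι : Type}

lemma eval_or (F G : Formula ι) (x : ι → Ternary) :
    (or F G).eval x = (neg (and (neg F) (neg G))).eval x :=
  kOr_eq_kNot_kAnd _ _

lemma eval_stable_of_eval_eq_some {F : Formula ι} {x : ι → Ternary} {y : ι → Bool} {b : Bool}
    (hy : IsResolution x y) (hx : F.eval x = some b) : F.eval (stable y) = some b := by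
  induction F generalizing b with
  | var i => exact ((hy i).resolve_left (by simp_all [eval])).symm.trans hx
  | neg F ih =>
    simp only [eval, kNot_eq_some] at hx ⊢
    exact ih hx
  | and F G ihF ihG =>
    cases b <;> simp only [eval, kAnd_eq_false, kAnd_eq_true] at hx ⊢
    · exact hx.imp ihF ihG
    · exact hx.imp ihF ihG
  | or F G ihF ihG =>
    rw [eval_or] at hx ⊢
    cases b <;> simp only [eval, kNot_eq_some, kAnd_eq_false, kAnd_eq_true, Bool.not_false,
      Bool.not_true] at hx ⊢
    · exact hx.imp ihF ihG
    · exact hx.imp ihF ihG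

theorem computes_and_isHazardFree_iff {F : Formula ι} {f : (ι → Bool) → Bool} :
    F.Computes f ∧ F.IsHazardFree ↔ ∀ x, F.eval x = extension f x := by
  refine ⟨fun ⟨hf, hF⟩ x => Option.ext fun b => ⟨fun hx => ?_, fun hx => ?_⟩, fun h => ⟨?_, ?_⟩⟩
  · refine extension_eq_some.2 fun y hy => Option.some_injective _ ?_
    rw [← hf y, eval_stable_of_eval_eq_some hy hx]
  · have hres := extension_eq_some.1 hx
    obtain ⟨y, hy⟩ := exists_isResolution x
    cases hFx : F.eval x with
    | none => exact (hF x ⟨hFx, b, fun w hw => by rw [hf w, hres w hw]⟩).elim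
    | some c => rw [← eval_stable_of_eval_eq_some hy hFx, hf y, hres y hy]
  · exact fun y => by rw [h, extension_stable]
  · rintro x ⟨hx, b, hb⟩
    have : extension f x = some b := extension_eq_some.2 fun y hy =>
      Option.some_injective _ (by rw [← hb y hy, h, extension_stable])
    simp [← h, hx] at this

/-! ### Hazard-free formulas exist -/

lemma exists_conjunction {α : Type*} {s : Finset α} (hs : s.Nonempty) (G : α → Formula ι) :
    ∃ F : Formula ι, ∀ x, (F.eval x = some true ↔ ∀ a ∈ s, (G a).eval x = some true) ∧
      (F.eval x = some false ↔ ∃ a ∈ s, (G a).eval x = some false) := by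
  induction hs using Finset.Nonempty.cons_induction with
  | singleton a => exact ⟨G a, by simp⟩
  | cons a s _ _ ih =>
    obtain ⟨F, hF⟩ := ih
    exact ⟨and (G a) F, fun x => by simp [eval, kAnd_eq_true, kAnd_eq_false, hF]⟩

lemma exists_disjunction {α : Type*} {s : Finset α} (hs : s.Nonempty) (G : α → Formula ι) :
    ∃ F : Formula ι, ∀ x, (F.eval x = some true ↔ ∃ a ∈ s, (G a).eval x = some true) ∧
      (F.eval x = some false ↔ ∀ a ∈ s, (G a).eval x = some false) := by
  obtain ⟨F, hF⟩ := exists_conjunction hs fun a => neg (G a)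
  exact ⟨neg F, fun x => by simp [eval, kNot_eq_some, hF]⟩

lemma exists_literal (i : ι) (b : Bool) :
    ∃ F : Formula ι, ∀ x c, F.eval x = some c ↔ x i = some (c == b) := by
  cases b
  · exact ⟨neg (var i), fun x c => by simp [eval, kNot_eq_some]⟩
  · exact ⟨var i, fun x c => by simp [eval]⟩

lemma exists_term [Finite ι] {z : ι → Ternary} (hz : ∃ i b, z i = some b) :
    ∃ F : Formula ι, ∀ x, (F.eval x = some true ↔ ∀ i b, z i = some b → x i = some b) ∧
      (F.eval x = some false ↔ ∃ i, ¬Compatible (z i) (x i)) := by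
  classical
  cases nonempty_fintype ι
  choose lit hlit using exists_literal (ι := ι)
  obtain ⟨i, b, hib⟩ := hz
  have hne : (Finset.univ.filter fun q : ι × Bool => z q.1 = some q.2).Nonempty :=
    ⟨(i, b), by simpa using hib⟩
  obtain ⟨F, hF⟩ := exists_conjunction hne fun q => lit q.1 q.2
  exact ⟨F, fun x => by simp [hF, hlit, not_compatible_iff]⟩

-- Huffman's construction: the disjunction of *all* implicants has no hazard.
theorem exists_eval_eq_extension [Finite ι] {f : (ι → Bool) → Bool} (h0 : ∃ y, f y = false)
    (h1 : ∃ y, f y = true) : ∃ F : Formula ι, ∀ x, F.eval x = extension f x := by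
  classical
  cases nonempty_fintype ι
  let implicants : Finset (ι → Ternary) := {z | extension f z = some true}
  have hterm (z : implicants) : ∃ i b, z.1 i = some b := by
    by_contra! hz
    obtain ⟨y, hy⟩ := h0
    have hres : IsResolution z.1 y := fun i => .inl (Option.eq_none_iff_forall_ne_some.2 (hz i))
    simp [extension_eq_some.1 (Finset.mem_filter.1 z.2).2 y hres] at hy
  choose T hT using fun z => exists_term (hterm z)
  obtain ⟨y₁, hy₁⟩ := h1
  have hne : (Finset.univ : Finset implicants).Nonempty :=
    ⟨⟨stable y₁, by simp [implicants, extension_stable, hy₁]⟩, Finset.mem_univ _⟩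
  obtain ⟨F, hF⟩ := exists_disjunction hne T
  refine ⟨F, fun x => Option.ext fun b => ?_⟩
  cases b
  · simp only [hF, hT, Finset.mem_univ, true_imp_iff, extension_eq_some, ← not_forall,
      ← exists_common_resolution_iff, not_exists, not_and, Subtype.forall, implicants,
      Finset.mem_filter, true_and]
    refine ⟨fun h y hy => ?_, fun h z hz y hzy hxy => by
      simpa [hz y hzy] using h y hxy⟩
    by_contra hfy
    exact h (stable y) (by simpa [isResolution_stable] using hfy) y (isResolution_stable.2 rfl) hy
  · simp only [hF, hT, Finset.mem_univ, true_and, extension_eq_some, Subtype.exists, implicants,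
      Finset.mem_filter, exists_prop]
    refine ⟨fun ⟨z, hz, hzx⟩ y hy => hz y fun i => ?_, fun h => ⟨x, h, fun _ _ => id⟩⟩
    cases hzi : z i with
    | none => exact .inl rfl
    | some b => simpa [hzx i b hzi] using hy i

end Formula

lemma hazardFreeDepth_ne_top {ι : Type} [Finite ι] {f : (ι → Bool) → Bool}
    (h : ∀ b, ∃ y, f y = b) : hazardFreeDepth f ≠ ⊤ := by
  obtain ⟨F, hF⟩ := Formula.exists_eval_eq_extension (h false) (h true)
  have hle : hazardFreeDepth f ≤ F.depth :=
    iInf₂_le F (Formula.computes_and_isHazardFree_iff.2 hF)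
  exact (hle.trans_lt (ENat.natCast_lt_top _)).ne

/-! ### The rank bound -/

section Mask

variable {K R C : Type*}

open Classical in
/-- The matrix `M` with all entries outside the rectangle `X × Y` replaced by zero. -/
noncomputable def mask [Zero K] (M : Matrix R C K) (X : Set R) (Y : Set C) : Matrix R C K :=
  Matrix.of fun r c => if r ∈ X ∧ c ∈ Y then M r c else 0

lemma mask_univ [Zero K] (M : Matrix R C K) : mask M Set.univ Set.univ = M := by
  ext
  simp [mask]

variable [Field K] [Fintype C]

lemma rank_add_le (A B : Matrix R C K) : (A + B).rank ≤ A.rank + B.rank := by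
  have hrange := LinearMap.range_add_le A.mulVecLin B.mulVecLin
  rw [← Matrix.mulVecLin_add] at hrange
  exact (Submodule.finrank_mono hrange).trans (Submodule.finrank_add_le_finrank_add_finrank _ _)

lemma rank_mask_le_left (M : Matrix R C K) (X S : Set R) (Y : Set C) :
    (mask M X Y).rank ≤ (mask M (X ∩ S) Y).rank + (mask M (X \ S) Y).rank := by
  have hsplit : mask M X Y = mask M (X ∩ S) Y + mask M (X \ S) Y := by
    ext r c
    simp only [mask, Matrix.of_apply, Matrix.add_apply, Set.mem_inter_iff, Set.mem_sdiff]
    grind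
  rw [hsplit]
  exact rank_add_le _ _

lemma rank_mask_le_right (M : Matrix R C K) (X : Set R) (Y S : Set C) :
    (mask M X Y).rank ≤ (mask M X (Y ∩ S)).rank + (mask M X (Y \ S)).rank := by
  have hsplit : mask M X Y = mask M X (Y ∩ S) + mask M X (Y \ S) := by
    ext r c
    simp only [mask, Matrix.of_apply, Matrix.add_apply, Set.mem_inter_iff, Set.mem_sdiff]
    grind
  rw [hsplit]
  exact rank_add_le _ _

lemma rank_mask_le_one {M : Matrix R C K} {X : Set R} {Y : Set C} {q : K}
    (h : ∀ r ∈ X, ∀ c ∈ Y, M r c = q) : (mask M X Y).rank ≤ 1 := by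
  classical
  have houter : mask M X Y =
      Matrix.vecMulVec (fun r => if r ∈ X then q else 0) fun c => if c ∈ Y then 1 else 0 := by
    ext r c
    by_cases hr : r ∈ X <;> by_cases hc : c ∈ Y <;>
      simp +contextual [mask, Matrix.vecMulVec_apply, hr, hc, h]
  rw [houter]
  exact Matrix.rank_vecMulVec_le _ _

end Mask

namespace Formula

variable {ι : Type} {K R C : Type*} [Field K] [Fintype C]
  {M : Matrix R C K} {x : R → ι → Ternary} {y : C → ι → Ternary}

/-- The rank bound for `F` on every rectangle of inputs that `F` separates. It is stated for
rectangles, and for both output values, so that it passes from formulas to larger ones. -/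
def RankBounded (M : Matrix R C K) (x : R → ι → Ternary) (y : C → ι → Ternary) (F : Formula ι) :
    Prop :=
  ∀ b (X : Set R) (Y : Set C), (∀ r ∈ X, F.eval (x r) = some b) →
    (∀ c ∈ Y, F.eval (y c) = some !b) → (mask M X Y).rank ≤ 2 ^ F.depth

namespace RankBounded

lemma var {i : ι} (h : ∀ b, ∃ q, ∀ r c, x r i = some b → y c i = some !b → M r c = q) :
    RankBounded M x y (var i) := by
  intro b X Y hX hY
  obtain ⟨q, hq⟩ := h b
  exact rank_mask_le_one fun r hr c hc => hq r c (hX r hr) (hY c hc)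

lemma neg {F : Formula ι} (hF : RankBounded M x y F) : RankBounded M x y (neg F) :=
  fun b X Y hX hY => hF (!b) X Y (fun r hr => kNot_eq_some.1 (hX r hr))
    (fun c hc => kNot_eq_some.1 (hY c hc))

lemma and {F G : Formula ι} (hF : RankBounded M x y F) (hG : RankBounded M x y G) :
    RankBounded M x y (and F G) := by
  have hpow : 2 ^ F.depth + 2 ^ G.depth ≤ 2 ^ (Formula.and F G).depth := by
    rw [depth, pow_succ, mul_two]
    gcongr <;> simp
  rintro (_ | _) X Y hX hY <;> simp only [eval, kAnd_eq_true, kAnd_eq_false, Bool.not_false,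
    Bool.not_true] at hX hY
  · refine (rank_mask_le_left M X {r | F.eval (x r) = some false} Y).trans
      ((add_le_add (hF false _ _ ?_ ?_) (hG false _ _ ?_ ?_)).trans hpow) <;> grind
  · refine (rank_mask_le_right M X Y {c | F.eval (y c) = some false}).trans
      ((add_le_add (hF true _ _ ?_ ?_) (hG true _ _ ?_ ?_)).trans hpow) <;> grind

lemma or {F G : Formula ι} (hF : RankBounded M x y F) (hG : RankBounded M x y G) :
    RankBounded M x y (or F G) := by
  intro b X Y hX hY
  simp only [eval_or] at hX hY
  exact (hF.neg.and hG.neg).neg b X Y hX hY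

end RankBounded

-- This is Razborov's rank measure, for the Karchmer-Wigderson game played on ternary points.
theorem rank_le_two_pow_depth {F : Formula ι}
    (h : ∀ i b, ∃ q, ∀ r c, x r i = some b → y c i = some !b → M r c = q)
    (hx : ∀ r, F.eval (x r) = some true) (hy : ∀ c, F.eval (y c) = some false) :
    M.rank ≤ 2 ^ F.depth := by
  have hF : RankBounded M x y F := by
    clear hx hy
    induction F with
    | var i => exact .var (h i)
    | neg F ihF => exact ihF.neg
    | and F G ihF ihG => exact ihF.and ihG
    | or F G ihF ihG => exact ihF.or ihG
  simpa only [mask_univ] using hF true Set.univ Set.univ (fun r _ => hx r) (fun c _ => hy c)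

end Formula

/-! ### The disjointness matrix -/

section DisjMatrix

open Finset

variable {α K : Type*} [Fintype α] [DecidableEq α] [Field K] {k : ℕ}

variable (α K k) in
/-- The disjointness matrix of the `k`-subsets of `α`. -/
def disjMatrix : Matrix {A : Finset α // #A = k} {A : Finset α // #A = k} K :=
  Matrix.of fun A B => if Disjoint A.1 B.1 then 1 else 0

/-- The sum of a function of the `k`-subsets over those disjoint from `T`. For a `k`-set `T` this
is an entry of the product of `disjMatrix` and `f`, but smaller `T` are needed as well. -/
def disjSum (f : {A : Finset α // #A = k} → K) (T : Finset α) : K :=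
  ∑ A with Disjoint T A.1, f A

lemma disjMatrix_mulVec (f : {A : Finset α // #A = k} → K) (B : {A : Finset α // #A = k}) :
    (disjMatrix α K k).mulVec f B = disjSum f B.1 := by
  simp [Matrix.mulVec, dotProduct, disjMatrix, disjSum, sum_filter]

lemma card_superset_disjoint {T : Finset α} (hT : #T ≤ k) (A : {A : Finset α // #A = k}) :
    #{B : {B : Finset α // #B = k} | T ⊆ B.1 ∧ Disjoint B.1 A.1} =
      if Disjoint T A.1 then (Fintype.card α - k - #T).choose (k - #T) else 0 := by
  split_ifs with hTA
  · have hcount := card_filter_powersetCard_subset _ _ _ (subset_compl_iff_disjoint_right.2 hTA) hT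
    rw [card_compl, A.2] at hcount
    rw [← hcount, ← card_map (.subtype _)]
    congr 1
    ext B
    simp only [mem_map, Function.Embedding.subtype_apply, Subtype.exists,
      mem_filter, mem_powersetCard, subset_compl_iff_disjoint_right]
    grind
  · exact card_eq_zero.2 (filter_eq_empty_iff.2 fun B _ h => hTA (disjoint_of_subset_left h.1 h.2))

lemma sum_disjSum_superset (f : {A : Finset α // #A = k} → K) {T : Finset α} (hT : #T ≤ k) :
    ∑ B : {B : Finset α // #B = k} with T ⊆ B.1, disjSum f B.1 =
      (Fintype.card α - k - #T).choose (k - #T) * disjSum f T := by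
  calc ∑ B : {B : Finset α // #B = k} with T ⊆ B.1, disjSum f B.1
      = ∑ A, #{B : {B : Finset α // #B = k} | T ⊆ B.1 ∧ Disjoint B.1 A.1} * f A := by
        simp only [disjSum, sum_filter _ f]
        rw [sum_comm]
        refine sum_congr rfl fun A _ => ?_
        rw [← sum_filter, filter_filter, sum_const, nsmul_eq_mul]
    _ = _ := by
        simp only [card_superset_disjoint hT, disjSum, mul_sum, sum_filter, Nat.cast_ite,
          Nat.cast_zero, ite_mul, zero_mul, mul_ite, mul_zero]

lemma sum_powerset_neg_one_pow_mul_disjSum (f : {A : Finset α // #A = k} → K)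
    (B : {A : Finset α // #A = k}) : ∑ T ∈ B.1.powerset, (-1) ^ #T * disjSum f T = f B := by
  have hinner (A : {A : Finset α // #A = k}) :
      ∑ T ∈ B.1.powerset with Disjoint T A.1, (-1 : K) ^ #T = if A = B then 1 else 0 := by
    have hpow : {T ∈ B.1.powerset | Disjoint T A.1} = (B.1 \ A.1).powerset := by
      ext T
      simp [subset_sdiff]
    have hempty : B.1 \ A.1 = ∅ ↔ A = B := by
      rw [sdiff_eq_empty_iff_subset, Subtype.ext_iff]
      exact ⟨fun h => (eq_of_subset_of_card_le h (by rw [A.2, B.2])).symm, fun h => h.ge⟩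
    have hsum := congrArg (Int.cast : ℤ → K) (sum_powerset_neg_one_pow_card (x := B.1 \ A.1))
    push_cast at hsum
    rw [hpow, hsum]
    simp only [hempty]
  calc ∑ T ∈ B.1.powerset, (-1) ^ #T * disjSum f T
      = ∑ A, (∑ T ∈ B.1.powerset with Disjoint T A.1, (-1 : K) ^ #T) * f A := by
        simp only [disjSum, sum_filter, mul_sum, sum_mul]
        rw [sum_comm]
        simp only [mul_ite, mul_zero, ite_mul, zero_mul]
    _ = f B := by simp [hinner]

-- Gottlieb's theorem, for the disjointness matrix.
theorem isUnit_disjMatrix [CharZero K] (h : 2 * k ≤ Fintype.card α) :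
    IsUnit (disjMatrix α K k) := by
  refine Matrix.mulVec_injective_iff_isUnit.1 <|
    (injective_iff_map_eq_zero (disjMatrix α K k).mulVecLin).2 fun f hf => funext fun B => ?_
  have hk (A : {A : Finset α // #A = k}) : disjSum f A.1 = 0 :=
    (disjMatrix_mulVec f A).symm.trans (congrFun hf A)
  have hsmall (T : Finset α) (hT : #T ≤ k) : disjSum f T = 0 := by
    have hsum := sum_disjSum_superset f hT
    simp only [hk, sum_const_zero, zero_eq_mul, Nat.cast_eq_zero, Nat.choose_eq_zero_iff] at hsum
    exact hsum.resolve_left (by omega)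
  rw [← sum_powerset_neg_one_pow_mul_disjSum f B]
  refine sum_eq_zero fun T hT => ?_
  rw [hsmall T ((card_le_card (mem_powerset.1 hT)).trans_eq B.2), mul_zero]

end DisjMatrix

/-! ### The compatibility matrix -/

section CompatMatrix

variable (ι : Type*) {K : Type*} [Fintype ι] [CommRing K]

/-- The inverse of the compatibility matrix of a single digit. -/
def digitInverse : Ternary → Ternary → K
  | none, none => -1
  | some a, some b => if a = b then 0 else -1
  | _, _ => 1

lemma sum_compatible_mul_digitInverse (a c : Ternary) :
    ∑ b, (if Compatible a b then 1 else 0) * digitInverse b c = if a = c then (1 : K) else 0 := by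
  rcases a with _ | _ | _ <;> rcases c with _ | _ | _ <;>
    simp [Fintype.sum_option, Compatible, digitInverse]
  norm_num

variable (K) in
/-- The matrix on ternary points whose entry is `1` where the two points have a common
resolution. -/
def compatMatrix : Matrix (ι → Ternary) (ι → Ternary) K :=
  Matrix.of fun s t => if ∀ i, Compatible (s i) (t i) then 1 else 0

variable [DecidableEq ι]

theorem isUnit_compatMatrix : IsUnit (compatMatrix ι K) := by
  let inverse : Matrix (ι → Ternary) (ι → Ternary) K :=
    Matrix.of fun s t => ∏ i, digitInverse (s i) (t i)
  have hinverse : compatMatrix ι K * inverse = 1 := by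
    ext s t
    simp only [Matrix.mul_apply, compatMatrix, inverse, Matrix.of_apply]
    calc ∑ z : ι → Ternary, (if ∀ i, Compatible (s i) (z i) then (1 : K) else 0) *
          ∏ i, digitInverse (z i) (t i)
        = ∑ z : ι → Ternary, ∏ i, (if Compatible (s i) (z i) then 1 else 0) *
            digitInverse (z i) (t i) := by
          simp only [Finset.prod_mul_distrib, Fintype.prod_ite_zero, Finset.prod_const_one]
      _ = ∏ i, ∑ a, (if Compatible (s i) a then 1 else 0) * digitInverse a (t i) :=
          (Fintype.prod_sum fun i a =>
            (if Compatible (s i) a then 1 else 0) * digitInverse a (t i)).symm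
      _ = (1 : Matrix _ _ K) s t := by
          simp only [sum_compatible_mul_digitInverse, Fintype.prod_ite_zero,
            Finset.prod_const_one, Matrix.one_apply, funext_iff]
  exact (Matrix.isUnit_iff_isUnit_det _).2 (Matrix.isUnit_det_of_right_inverse hinverse)

end CompatMatrix

/-! ### Compositions with the multiplexer -/

section LowerBound

variable {ρ : Type} {f : (ρ → Bool) → Bool} {b : Bool} {m : ℕ}

/-- The set `S` of coordinates is a `b`-certificate of `f`: the value of `f` is `b` as soon as all
the coordinates in `S` are `b`. -/
def Forces (f : (ρ → Bool) → Bool) (S : Set ρ) (b : Bool) : Prop :=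
  ∀ x, (∀ i ∈ S, x i = b) → f x = b

open Classical in
/-- The ternary point all of whose rows have address `s`, and in which exactly the data bits in the
rows from `S` that a resolution of `s` may select are stable, with value `b`. -/
noncomputable def muxInput (s : Fin m → Ternary) (b : Bool) (S : Set ρ) :
    ρ × (Fin m ⊕ (Fin m → Bool)) → Ternary
  | (_, .inl i) => s i
  | (r, .inr p) => if IsResolution s p ∧ r ∈ S then some b else none

lemma extension_muxInput {S : Set ρ} (h : Forces f S b) (s : Fin m → Ternary) :
    extension (blockComp f (mux m)) (muxInput s b S) = some b := by
  refine extension_eq_some.2 fun z hz => h _ fun r hr => ?_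
  have haddress : IsResolution s fun i => z (r, .inl i) := fun i => hz (r, .inl i)
  simpa [muxInput, haddress, hr, mux, eq_comm] using hz (r, .inr fun i => z (r, .inl i))

open scoped Kronecker in
theorem card_mul_three_pow_le_two_pow_depth {K R : Type*} [Field K] [Fintype R] [DecidableEq R]
    {M : Matrix R R K} (hM : IsUnit M) {P Q : R → Set ρ} (hP : ∀ r, Forces f (P r) true)
    (hQ : ∀ c, Forces f (Q c) false) (hPQ : ∀ i, ∃ q, ∀ r c, i ∈ P r → i ∈ Q c → M r c = q)
    {F : Formula (ρ × (Fin m ⊕ (Fin m → Bool)))} (hF : F.Computes (blockComp f (mux m)))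
    (hF' : F.IsHazardFree) : Fintype.card R * 3 ^ m ≤ 2 ^ F.depth := by
  have hrank : (M ⊗ₖ compatMatrix (Fin m) K).rank = Fintype.card R * 3 ^ m := by
    rw [Matrix.rank_of_isUnit _ (Matrix.IsUnit.kronecker hM (isUnit_compatMatrix _))]
    simp
  have heval := Formula.computes_and_isHazardFree_iff.1 ⟨hF, hF'⟩
  rw [← hrank]
  refine Formula.rank_le_two_pow_depth (x := fun a => muxInput a.2 true (P a.1))
    (y := fun a => muxInput a.2 false (Q a.1)) ?_
    (fun a => (heval _).trans (extension_muxInput (hP a.1) a.2))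
    (fun a => (heval _).trans (extension_muxInput (hQ a.1) a.2))
  rintro ⟨r, i | p⟩ b
  · refine ⟨0, fun a a' hs ht => ?_⟩
    have : ¬∀ j, Compatible (a.2 j) (a'.2 j) := fun h => not_compatible_iff.2 ⟨b, hs, ht⟩ (h i)
    simp [compatMatrix, this]
  · obtain ⟨q, hq⟩ := hPQ r
    refine ⟨q, fun a a' hs ht => ?_⟩
    simp only [muxInput, Option.ite_none_right_eq_some] at hs ht
    have : ∀ j, Compatible (a.2 j) (a'.2 j) := exists_common_resolution_iff.1 ⟨p, hs.1.1, ht.1.1⟩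
    simp [compatMatrix, this, hq _ _ hs.1.2 ht.1.2]

theorem clog_card_mul_three_pow_le_hazardFreeDepth {K R : Type*} [Field K] [Fintype R]
    [DecidableEq R] {M : Matrix R R K} (hM : IsUnit M) {P Q : R → Set ρ}
    (hP : ∀ r, Forces f (P r) true) (hQ : ∀ c, Forces f (Q c) false)
    (hPQ : ∀ i, ∃ q, ∀ r c, i ∈ P r → i ∈ Q c → M r c = q) :
    (Nat.clog 2 (Fintype.card R * 3 ^ m) : ℕ∞) ≤ hazardFreeDepth (blockComp f (mux m)) :=
  le_iInf₂ fun _ hF => Nat.cast_le.2 <| Nat.clog_le_of_le_pow <|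
    card_mul_three_pow_le_two_pow_depth hM hP hQ hPQ hF.1 hF.2

end LowerBound

/-! ### The set covering function -/

section IsolatedNeighbours

open Finset

variable {α ι : Type*} [Fintype α] [Fintype ι] {k : ℕ}

/-- The isolated neighbour condition, for the bipartite graph in which `N v` is the neighbourhood
of `v`: for disjoint `k`-sets `A` and `B`, some `v` is adjacent to all of `A` and none of `B`. -/
def IsolatedNeighbours (k : ℕ) (N : ι → Finset α) : Prop :=
  ∀ A B : Finset α, #A = k → #B = k → Disjoint A B → ∃ v, A ⊆ N v ∧ Disjoint B (N v)

lemma exists_forall_exists_of_sum_card_lt {β τ : Type*} [Fintype τ] {P : Finset β}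
    {good : τ → β → Prop} [∀ t a, Decidable (good t a)]
    (h : ∑ a ∈ P, #{t | ¬good t a} ^ Fintype.card ι < Fintype.card τ ^ Fintype.card ι) :
    ∃ t : ι → τ, ∀ a ∈ P, ∃ v, good (t v) a := by
  classical
  by_contra! hbad
  have hcover : (univ : Finset (ι → τ)) ⊆
      P.biUnion fun a => Fintype.piFinset fun _ => {t | ¬good t a} := by
    intro t _
    simpa using hbad t
  have hcard := (card_le_card hcover).trans card_biUnion_le
  simp only [Fintype.card_piFinset, prod_const, card_univ, Fintype.card_fun] at hcard
  exact hcard.not_gt h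

lemma card_not_separating [DecidableEq α] {A B : Finset α} (hA : #A = k) (hB : #B = k)
    (hAB : Disjoint A B) :
    (#{T | ¬(A ⊆ T ∧ Disjoint B T)} : ℝ) = (1 - 1 / 4 ^ k) * 2 ^ Fintype.card α := by
  have hIcc : ({T | A ⊆ T ∧ Disjoint B T} : Finset (Finset α)) = Icc A Bᶜ := by
    ext T
    simp [subset_compl_iff_disjoint_left]
  have hcard : 2 * k ≤ Fintype.card α := by
    rw [two_mul]
    nth_rw 1 [← hA]
    rw [← hB, ← card_union_of_disjoint hAB]
    exact card_le_univ _
  have hgood : #{T | A ⊆ T ∧ Disjoint B T} * 4 ^ k = 2 ^ Fintype.card α := by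
    rw [hIcc, card_Icc_finset (subset_compl_iff_disjoint_right.2 hAB), card_compl, hA, hB,
      show 4 = 2 ^ 2 by norm_num, ← pow_mul, ← pow_add]
    congr 1
    omega
  have htotal := card_filter_add_card_filter_not (s := univ) fun T => A ⊆ T ∧ Disjoint B T
  rw [card_univ, Fintype.card_finset] at htotal
  have hgood' : (#{T | A ⊆ T ∧ Disjoint B T} : ℝ) * 4 ^ k = 2 ^ Fintype.card α := by
    exact_mod_cast hgood
  have htotal' : (#{T | A ⊆ T ∧ Disjoint B T} : ℝ) + #{T | ¬(A ⊆ T ∧ Disjoint B T)} =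
      2 ^ Fintype.card α := by
    exact_mod_cast htotal
  rw [← hgood'] at htotal' ⊢
  field_simp
  linarith

theorem exists_isolatedNeighbours
    (h : (1 - 1 / 4 ^ k : ℝ) ^ Fintype.card ι * (Fintype.card α : ℝ) ^ (2 * k) < 1) :
    ∃ N : ι → Finset α, IsolatedNeighbours k N := by
  classical
  let P : Finset (Finset α × Finset α) :=
    {p ∈ univ.powersetCard k ×ˢ univ.powersetCard k | Disjoint p.1 p.2}
  have hP : (#P : ℝ) ≤ (Fintype.card α : ℝ) ^ (2 * k) := by
    have hchoose : #P ≤ (Fintype.card α).choose k * (Fintype.card α).choose k := by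
      simpa using card_filter_le (univ.powersetCard k ×ˢ univ.powersetCard k) _
    rw [two_mul, pow_add]
    exact_mod_cast hchoose.trans (Nat.mul_le_mul (Nat.choose_le_pow _ _) (Nat.choose_le_pow _ _))
  have hsum : ∑ p ∈ P, #{T | ¬(p.1 ⊆ T ∧ Disjoint p.2 T)} ^ Fintype.card ι <
      Fintype.card (Finset α) ^ Fintype.card ι := by
    have hterm (p) (hp : p ∈ P) : (#{T | ¬(p.1 ⊆ T ∧ Disjoint p.2 T)} : ℝ) =
        (1 - 1 / 4 ^ k) * 2 ^ Fintype.card α := by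
      simp only [P, mem_filter, mem_product, mem_powersetCard_univ] at hp
      exact card_not_separating hp.1.1 hp.1.2 hp.2
    rw [← Nat.cast_lt (α := ℝ)]
    push_cast
    rw [sum_congr rfl fun p hp => by rw [hterm p hp], sum_const, nsmul_eq_mul, mul_pow,
      Fintype.card_finset, Nat.cast_pow, Nat.cast_ofNat]
    have hq : (0 : ℝ) ≤ 1 - 1 / 4 ^ k :=
      sub_nonneg.2 (div_le_self zero_le_one (one_le_pow₀ (by norm_num)))
    have hlt : #P * (1 - 1 / 4 ^ k : ℝ) ^ Fintype.card ι < 1 := by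
      rw [mul_comm]
      exact (mul_le_mul_of_nonneg_left hP (pow_nonneg hq _)).trans_lt h
    rw [← mul_assoc]
    exact mul_lt_of_lt_one_left (by positivity) hlt
  obtain ⟨N, hN⟩ := exists_forall_exists_of_sum_card_lt hsum
  exact ⟨N, fun A B hA hB hAB => hN (A, B) (by simp [P, hA, hB, hAB])⟩

end IsolatedNeighbours

section SetCovering

open Finset

variable {k n m : ℕ} {E : Fin n × Fin n → Bool} {N : Fin n → Finset (Fin n)}

lemma setCovering_eq_true :
    setCovering k n E = true ↔ ∃ S : Finset (Fin n), #S = k ∧ ∀ v, ∃ u ∈ S, E (u, v) = true := by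
  simp [setCovering]

lemma setCovering_eq_false :
    setCovering k n E = false ↔
      ∀ S : Finset (Fin n), #S = k → ∃ v, ∀ u ∈ S, E (u, v) = false := by
  simp [setCovering]

/-- A set of edges whose presence makes `A` a covering set, whatever the bipartite graph `N` is.
Edges of `N` at `v` are used only if all of `A` is adjacent to `v`: then they lie in the uncovering
certificate of `B` only if `A` and `B` are disjoint. -/
def coveringCertificate (N : Fin n → Finset (Fin n)) (A : Finset (Fin n)) : Set (Fin n × Fin n) :=
  {e | e.1 ∈ A ∧ (e.1 ∈ N e.2 → A ⊆ N e.2)}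

/-- A set of edges whose absence excludes all covering sets of size `#B`, if `N` satisfies the
isolated neighbour condition. -/
def uncoveringCertificate (N : Fin n → Finset (Fin n)) (B : Finset (Fin n)) :
    Set (Fin n × Fin n) :=
  {e | if e.1 ∈ N e.2 then Disjoint B (N e.2) else e.1 ∈ B}

lemma forces_coveringCertificate (hk : 1 ≤ k) {A : Finset (Fin n)} (hA : #A = k) :
    Forces (setCovering k n) (coveringCertificate N A) true := by
  refine fun E hE => setCovering_eq_true.2 ⟨A, hA, fun v => ?_⟩
  obtain ⟨w, hw⟩ : A.Nonempty := card_pos.1 (by omega)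
  by_cases hAN : A ⊆ N v
  · exact ⟨w, hw, hE (w, v) ⟨hw, fun _ => hAN⟩⟩
  · obtain ⟨u, hu, huN⟩ := not_subset.1 hAN
    exact ⟨u, hu, hE (u, v) ⟨hu, fun h => (huN h).elim⟩⟩

lemma forces_uncoveringCertificate (hkn : 2 * k ≤ n) (hN : IsolatedNeighbours k N)
    {B : Finset (Fin n)} (hB : #B = k) :
    Forces (setCovering k n) (uncoveringCertificate N B) false := by
  refine fun E hE => setCovering_eq_false.2 fun S hS => ?_
  -- The isolated neighbour of a `k`-set that contains `S \ B` and misses `B` is not covered by `S`.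
  obtain ⟨A, hSA, hAB, hA⟩ : ∃ A, S \ B ⊆ A ∧ A ⊆ Bᶜ ∧ #A = k :=
    exists_subsuperset_card_eq (fun u hu => mem_compl.2 (mem_sdiff.1 hu).2)
      ((card_le_card sdiff_subset).trans_eq hS) (by rw [card_compl, hB, Fintype.card_fin]; omega)
  obtain ⟨v, hAv, hBv⟩ := hN A B hA hB (subset_compl_iff_disjoint_right.1 hAB)
  refine ⟨v, fun u hu => hE (u, v) ?_⟩
  by_cases huN : u ∈ N v
  · simpa [uncoveringCertificate, huN] using hBv
  · have huB : u ∈ B := by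
      by_contra h
      exact huN (hAv (hSA (mem_sdiff.2 ⟨hu, h⟩)))
    simpa [uncoveringCertificate, huN] using huB

lemma disjoint_iff_of_mem_certificates {A B : Finset (Fin n)} {e : Fin n × Fin n}
    (hA : e ∈ coveringCertificate N A) (hB : e ∈ uncoveringCertificate N B) :
    Disjoint A B ↔ e.1 ∈ N e.2 := by
  simp only [coveringCertificate, uncoveringCertificate, Set.mem_ofPred_eq] at hA hB
  split_ifs at hB with he
  · exact iff_of_true (disjoint_of_subset_left (hA.2 he) hB.symm) he
  · exact iff_of_false (fun h => disjoint_left.1 h hA.1 hB) he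

theorem clog_choose_mul_three_pow_le_hazardFreeDepth (hk : 1 ≤ k) (hkn : 2 * k ≤ n)
    (hN : IsolatedNeighbours k N) :
    (Nat.clog 2 (n.choose k * 3 ^ m) : ℕ∞) ≤
      hazardFreeDepth (blockComp (setCovering k n) (mux m)) := by
  have hM : IsUnit (disjMatrix (Fin n) ℚ k) := isUnit_disjMatrix (by rwa [Fintype.card_fin])
  have hbound := clog_card_mul_three_pow_le_hazardFreeDepth (m := m) hM
    (fun A => forces_coveringCertificate (N := N) hk A.2)
    (fun B => forces_uncoveringCertificate hkn hN B.2)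
    fun e => ⟨if e.1 ∈ N e.2 then 1 else 0, fun A B hA hB => by
      simp only [disjMatrix, Matrix.of_apply, disjoint_iff_of_mem_certificates hA hB]⟩
  rwa [Fintype.card_finset_len, Fintype.card_fin] at hbound

lemma exists_blockComp_setCovering_mux_eq (hk : 1 ≤ k) (hkn : k ≤ n) (b : Bool) :
    ∃ X, blockComp (setCovering k n) (mux m) X = b := by
  refine ⟨fun _ => b, ?_⟩
  cases b
  · exact setCovering_eq_false.2 fun _ _ => ⟨⟨0, by omega⟩, fun _ _ => rfl⟩
  · obtain ⟨S, -, hS⟩ := exists_subset_card_eq (s := (univ : Finset (Fin n))) (n := k) (by simpa)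
    obtain ⟨u, hu⟩ : S.Nonempty := card_pos.1 (by omega)
    exact setCovering_eq_true.2 ⟨S, hS, fun _ => ⟨u, hu, rfl⟩⟩

end SetCovering

/-! ### Hazard derivatives -/

section HazardDerivative

variable {ι κ : Type} {f : (ι → Bool) → Bool} {x y z : ι → Bool}

lemma isResolution_perturb :
    IsResolution (perturb x y) z ↔ ∀ i, z i ≠ x i → y i = true := by
  refine forall_congr' fun i => ?_
  by_cases h : y i = true <;> simp [perturb, h, eq_comm]

lemma hazardDerivative_eq_true :
    hazardDerivative f x y = true ↔ ∃ z, (∀ i, z i ≠ x i → y i = true) ∧ f z ≠ f x := by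
  have hx : IsResolution (perturb x y) x := isResolution_perturb.2 fun i h => (h rfl).elim
  simp only [hazardDerivative, decide_eq_true_iff, Option.eq_none_iff_forall_ne_some, ne_eq,
    extension_eq_some, isResolution_perturb]
  refine ⟨fun h => by simpa using h (f x), fun ⟨z, hz, hne⟩ b hb => hne ?_⟩
  rw [hb z hz, hb x (isResolution_perturb.1 hx)]

lemma exists_apply_eq_iff {b : Bool} :
    (∃ z, (∀ i, z i ≠ x i → y i = true) ∧ f z = b) ↔
      (b ≠ f x → hazardDerivative f x y = true) := by
  rw [hazardDerivative_eq_true]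
  by_cases hb : b = f x
  · exact iff_of_true ⟨x, fun i h => (h rfl).elim, hb.symm⟩ fun h => (h hb).elim
  · obtain rfl := Bool.eq_not.2 hb
    simp [Bool.eq_not]

theorem hazardDerivative_blockComp {g : (κ → Bool) → Bool} {x y : ι × κ → Bool} :
    hazardDerivative (blockComp f g) x y =
      hazardDerivative f (fun i => g fun j => x (i, j)) fun i =>
        hazardDerivative g (fun j => x (i, j)) fun j => y (i, j) := by
  rw [Bool.eq_iff_iff, hazardDerivative_eq_true, hazardDerivative_eq_true]
  constructor
  · rintro ⟨z, hz, hne⟩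
    exact ⟨fun i => g fun j => z (i, j),
      fun i => exists_apply_eq_iff.1 ⟨fun j => z (i, j), fun j => hz (i, j), rfl⟩, hne⟩
  · rintro ⟨w, hw, hne⟩
    choose z hz hzw using fun i => exists_apply_eq_iff.2 (hw i)
    refine ⟨fun e => z e.1 e.2, fun e => hz e.1 e.2, ?_⟩
    simpa only [blockComp, hzw] using hne

lemma hazardDerivative_bot : hazardDerivative f x ⊥ = false := by
  rw [Bool.eq_false_iff, ne_eq, hazardDerivative_eq_true]
  rintro ⟨z, hz, hne⟩
  exact hne (congrArg f (funext fun i => by simpa using mt (hz i)))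

lemma hazardDerivative_top (h : ∀ b, ∃ z, f z = b) : hazardDerivative f x ⊤ = true := by
  obtain ⟨z, hz⟩ := h !(f x)
  exact hazardDerivative_eq_true.2 ⟨z, by simp, by simp [hz]⟩

lemma hazardDerivative_eq_true_of_monotone_of_eq_false (hf : Monotone f) (hx : f x = false) :
    hazardDerivative f x y = true ↔ f (x ⊔ y) = true := by
  simp only [hazardDerivative_eq_true, hx, ne_eq, Bool.not_eq_false]
  constructor
  · rintro ⟨z, hz, hfz⟩
    have hle : z ≤ x ⊔ y := fun i => by
      specialize hz i
      cases hxi : x i <;> cases hyi : y i <;> simp_all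
    exact hf hle hfz
  · intro h
    refine ⟨x ⊔ y, fun i => ?_, h⟩
    cases hxi : x i <;> simp [hxi]

lemma hazardDerivative_eq_true_of_monotone_of_eq_true (hf : Monotone f) (hx : f x = true) :
    hazardDerivative f x y = true ↔ f (x ⊓ yᶜ) = false := by
  simp only [hazardDerivative_eq_true, hx, ne_eq, Bool.not_eq_true]
  constructor
  · rintro ⟨z, hz, hfz⟩
    have hle : x ⊓ yᶜ ≤ z := fun i => by
      specialize hz i
      cases hxi : x i <;> cases hyi : y i <;> simp_all
    exact Bool.eq_false_of_le_false ((hf hle).trans_eq hfz)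
  · intro h
    refine ⟨x ⊓ yᶜ, fun i => ?_, h⟩
    cases hxi : x i <;> simp [hxi]

lemma monotone_setCovering (k n : ℕ) : Monotone (setCovering k n) := fun E E' hE h => by
  obtain ⟨S, hS, hcov⟩ := setCovering_eq_true.1 h
  refine setCovering_eq_true.2 ⟨S, hS, fun v => ?_⟩
  obtain ⟨u, hu, huv⟩ := hcov v
  exact ⟨u, hu, hE (u, v) huv⟩

lemma hazardDerivative_mux {m : ℕ} {x y : Fin m ⊕ (Fin m → Bool) → Bool} :
    hazardDerivative (mux m) x y = true ↔ ∃ p : Fin m → Bool,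
      (x (.inr p) ≠ mux m x ∨ y (.inr p) = true) ∧ ∀ i, p i ≠ x (.inl i) → y (.inl i) = true := by
  classical
  rw [hazardDerivative_eq_true]
  constructor
  · rintro ⟨z, hz, hne⟩
    refine ⟨fun i => z (.inl i), or_iff_not_imp_left.2 fun h => hz _ ?_, fun i => hz _⟩
    exact (not_not.1 h).symm ▸ hne
  · rintro ⟨p, hp, hy⟩
    refine ⟨Sum.elim p (Function.update (x ∘ .inr) p !(mux m x)), ?_, by simp [mux]⟩
    rintro (i | q) hq
    · exact hy i hq
    · obtain rfl : q = p := by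
        by_contra hqp
        simp [hqp] at hq
      exact hp.resolve_left fun h => hq (by simpa using (Bool.eq_not.2 h).symm)

end HazardDerivative

/-! ### Monotone formulas for hazard derivatives -/

section MonotoneFormulas

open Finset

variable {ι : Type}

/-- The predicate is constant or decided by a monotone formula of depth at most `d`. Constants are
admitted separately because formulas have no constant leaves. -/
def MonotoneDepthLE (P : (ι → Bool) → Prop) (d : ℕ) : Prop :=
  (∀ y, P y) ∨ (∀ y, ¬P y) ∨
    ∃ F : Formula ι, F.IsMonotone ∧ F.depth ≤ d ∧
      ∀ y, (F.eval (stable y) = some true ↔ P y) ∧ (F.eval (stable y) = some false ↔ ¬P y)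

namespace MonotoneDepthLE

variable {P Q : (ι → Bool) → Prop} {d e : ℕ}

lemma const (p : Prop) (d : ℕ) : MonotoneDepthLE (fun _ : ι → Bool => p) d := by
  by_cases hp : p
  · exact .inl fun _ => hp
  · exact .inr (.inl fun _ => hp)

lemma var (i : ι) (d : ℕ) : MonotoneDepthLE (fun y : ι → Bool => y i = true) d :=
  .inr (.inr ⟨.var i, trivial, d.zero_le, fun y => by simp [Formula.eval, stable]⟩)

lemma mono (hP : MonotoneDepthLE P d) (hde : d ≤ e) : MonotoneDepthLE P e :=
  hP.imp_right (.imp_right fun ⟨F, hF, hdepth, heval⟩ => ⟨F, hF, hdepth.trans hde, heval⟩)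

lemma const_or (p : Prop) (hP : MonotoneDepthLE P d) : MonotoneDepthLE (fun y => p ∨ P y) d := by
  by_cases hp : p
  · simpa [hp] using const True d
  · simpa [hp] using hP

lemma const_imp (p : Prop) (hP : MonotoneDepthLE P d) : MonotoneDepthLE (fun y => p → P y) d := by
  simpa only [imp_iff_not_or] using hP.const_or (¬p)

lemma and (hP : MonotoneDepthLE P d) (hQ : MonotoneDepthLE Q d) :
    MonotoneDepthLE (fun y => P y ∧ Q y) (d + 1) := by
  rcases id hP with h | h | ⟨F, hF, hFd, hFP⟩
  · simpa [h] using hQ.mono d.le_succ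
  · simpa [h] using const False (d + 1)
  rcases hQ with h | h | ⟨G, hG, hGd, hGQ⟩
  · simpa [h] using hP.mono d.le_succ
  · simpa [h] using const False (d + 1)
  refine .inr (.inr ⟨.and F G, ⟨hF, hG⟩, by simp [Formula.depth, hFd, hGd], fun y => ?_⟩)
  simp only [Formula.eval, kAnd_eq_true, kAnd_eq_false, hFP, hGQ, not_and_or, iff_self, and_self]

lemma or (hP : MonotoneDepthLE P d) (hQ : MonotoneDepthLE Q d) :
    MonotoneDepthLE (fun y => P y ∨ Q y) (d + 1) := by
  rcases id hP with h | h | ⟨F, hF, hFd, hFP⟩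
  · simpa [h] using const True (d + 1)
  · simpa [h] using hQ.mono d.le_succ
  rcases hQ with h | h | ⟨G, hG, hGd, hGQ⟩
  · simpa [h] using const True (d + 1)
  · simpa [h] using hP.mono d.le_succ
  refine .inr (.inr ⟨.or F G, ⟨hF, hG⟩, by simp [Formula.depth, hFd, hGd], fun y => ?_⟩)
  rw [Formula.eval_or]
  simp only [Formula.eval, kNot_eq_some, kAnd_eq_false, kAnd_eq_true,
    Bool.not_true, Bool.not_false, hFP, hGQ, not_or, iff_self, and_self]

end MonotoneDepthLE

lemma finset_halving_induction {α : Type*} [DecidableEq α]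
    {motive : ∀ (e : ℕ) (s : Finset α), #s ≤ 2 ^ e → Prop}
    (empty : motive 0 ∅ zero_le_one) (singleton : ∀ a, motive 0 {a} le_rfl)
    (union : ∀ e s t hs ht hst, motive e s hs → motive e t ht → motive (e + 1) (s ∪ t) hst)
    {e : ℕ} {s : Finset α} (hs : #s ≤ 2 ^ e) : motive e s hs := by
  induction e generalizing s with
  | zero =>
    obtain h | h : #s = 0 ∨ #s = 1 := Nat.le_one_iff_eq_zero_or_eq_one.1 hs
    · obtain rfl := card_eq_zero.1 h
      exact empty
    · obtain ⟨a, rfl⟩ := card_eq_one.1 h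
      exact singleton a
  | succ e ih =>
    obtain ⟨t, r, rfl, ht, hr⟩ : ∃ t r, t ∪ r = s ∧ #t ≤ 2 ^ e ∧ #r ≤ 2 ^ e := by
      obtain ⟨t, hts, ht⟩ := exists_subset_card_eq (min_le_right (2 ^ e) #s)
      refine ⟨t, s \ t, union_sdiff_of_subset hts, by omega, ?_⟩
      rw [card_sdiff_of_subset hts, ht]
      omega
    exact union e t r ht hr hs (ih ht) (ih hr)

namespace MonotoneDepthLE

variable {α : Type*} {P : α → (ι → Bool) → Prop} {d e : ℕ} {s : Finset α}

lemma forall_mem (hs : #s ≤ 2 ^ e) (hP : ∀ a ∈ s, MonotoneDepthLE (P a) d) :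
    MonotoneDepthLE (fun y => ∀ a ∈ s, P a y) (d + e) := by
  classical
  induction hs using finset_halving_induction with
  | empty => simpa using const True d
  | singleton a => simpa using hP
  | union e s t _ _ _ ihs iht =>
    simp only [forall_mem_union] at hP ⊢
    exact (ihs hP.1).and (iht hP.2)

lemma exists_mem (hs : #s ≤ 2 ^ e) (hP : ∀ a ∈ s, MonotoneDepthLE (P a) d) :
    MonotoneDepthLE (fun y => ∃ a ∈ s, P a y) (d + e) := by
  classical
  induction hs using finset_halving_induction with
  | empty => simpa using const False d
  | singleton a => simpa using hP
  | union e s t _ _ _ ihs iht =>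
    rw [forall_mem_union] at hP
    simp only [mem_union, or_and_right, exists_or]
    exact (ihs hP.1).or (iht hP.2)

end MonotoneDepthLE

lemma MonotoneDepthLE.monotoneDepth_le {f : (ι → Bool) → Bool} {d : ℕ}
    (hf : MonotoneDepthLE (fun y => f y = true) d) (h : ∀ b, ∃ y, f y = b) :
    monotoneDepth f ≤ d := by
  obtain ⟨y₀, h₀⟩ := h false
  obtain ⟨y₁, h₁⟩ := h true
  obtain hf | hf | ⟨F, hF, hFd, hFf⟩ := hf
  · exact absurd (hf y₀) (by simp [h₀])
  · exact absurd h₁ (hf y₁)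
  · have hcomputes : F.Computes f := fun y => by
      cases hy : f y
      · exact (hFf y).2.2 (by simp [hy])
      · exact (hFf y).1.2 hy
    exact (iInf₂_le F ⟨hcomputes, hF⟩).trans (mod_cast hFd)

lemma monotoneDepthLE_hazardDerivative_mux {m : ℕ} (x : Fin m ⊕ (Fin m → Bool) → Bool)
    (φ : Fin m ⊕ (Fin m → Bool) → ι) :
    MonotoneDepthLE (fun y => hazardDerivative (mux m) x (fun j => y (φ j)) = true)
      (Nat.clog 2 m + 1 + m) := by
  have hcard : #(univ : Finset (Fin m)) ≤ 2 ^ Nat.clog 2 m := by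
    simpa using Nat.le_pow_clog one_lt_two m
  have hfixed (p : Fin m → Bool) : MonotoneDepthLE
      (fun y => ∀ i ∈ univ, p i ≠ x (.inl i) → y (φ (.inl i)) = true) (0 + Nat.clog 2 m) :=
    .forall_mem hcard fun i _ => (MonotoneDepthLE.var _ 0).const_imp _
  have hexists := MonotoneDepthLE.exists_mem (s := univ) (e := m) (by simp) fun p _ =>
    ((MonotoneDepthLE.var (φ (.inr p)) _).const_or (x (.inr p) ≠ mux m x)).and (hfixed p)
  simpa only [hazardDerivative_mux, mem_univ, true_and, true_imp_iff, zero_add] using hexists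

lemma MonotoneDepthLE.hazardDerivative_setCovering {k n d : ℕ} (E : Fin n × Fin n → Bool)
    {W : Fin n × Fin n → (ι → Bool) → Bool}
    (hW : ∀ e, MonotoneDepthLE (fun y => W e y = true) d) :
    MonotoneDepthLE (fun y => hazardDerivative (setCovering k n) E (fun e => W e y) = true)
      (d + Nat.clog 2 k + Nat.clog 2 n + Nat.clog 2 (n.choose k)) := by
  have hS : #((univ : Finset (Fin n)).powersetCard k) ≤ 2 ^ Nat.clog 2 (n.choose k) := by
    simpa using Nat.le_pow_clog one_lt_two (n.choose k)
  have hv : #(univ : Finset (Fin n)) ≤ 2 ^ Nat.clog 2 n := by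
    simpa using Nat.le_pow_clog one_lt_two n
  have hu : ∀ S ∈ (univ : Finset (Fin n)).powersetCard k, #S ≤ 2 ^ Nat.clog 2 k := fun S hS =>
    (mem_powersetCard.1 hS).2 ▸ Nat.le_pow_clog one_lt_two k
  cases hE : setCovering k n E
  · have hbound := exists_mem hS fun S hS => forall_mem hv fun v _ => exists_mem (hu S hS)
      fun u _ => (hW (u, v)).const_or (E (u, v) = true)
    simpa [hazardDerivative_eq_true_of_monotone_of_eq_false (monotone_setCovering k n) hE,
      setCovering_eq_true] using hbound
  · have hbound := forall_mem hS fun S hS => exists_mem hv fun v _ => forall_mem (hu S hS)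
      fun u _ => (hW (u, v)).const_imp (E (u, v) = true)
    simpa [hazardDerivative_eq_true_of_monotone_of_eq_true (monotone_setCovering k n) hE,
      setCovering_eq_false] using hbound

theorem monotoneDepth_hazardDerivative_le {k n m : ℕ} (hk : 1 ≤ k) (hkn : k ≤ n)
    (x : (Fin n × Fin n) × (Fin m ⊕ (Fin m → Bool)) → Bool) :
    monotoneDepth (hazardDerivative (blockComp (setCovering k n) (mux m)) x) ≤
      (Nat.clog 2 m + 1 + m + Nat.clog 2 k + Nat.clog 2 n + Nat.clog 2 (n.choose k) : ℕ) := by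
  refine MonotoneDepthLE.monotoneDepth_le ?_ fun b => ?_
  · simp only [hazardDerivative_blockComp]
    exact .hazardDerivative_setCovering _ fun e =>
      monotoneDepthLE_hazardDerivative_mux _ fun j => (e, j)
  · cases b
    · exact ⟨⊥, hazardDerivative_bot⟩
    · exact ⟨⊤, hazardDerivative_top (exists_blockComp_setCovering_mux_eq hk hkn)⟩

end MonotoneFormulas

/-! ### Estimates -/

section Estimates

open Real

variable {n k : ℕ}

lemma logb_two_le_div_four {x : ℝ} (hx : 16 ≤ x) : logb 2 x ≤ x / 4 := by
  have htangent : log (x / 16) ≤ x / 16 - 1 := log_le_sub_one_of_pos (by positivity)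
  have hlog : log x = log (x / 16) + 4 * log 2 := by
    rw [log_div (by positivity) (by norm_num), show (16 : ℝ) = 2 ^ 4 by norm_num, log_pow]
    push_cast
    ring
  rw [logb, div_le_iff₀ (log_pos one_lt_two)]
  nlinarith [log_two_gt_d9]

lemma sqrt_natCast_eq_two_rpow (hn : 1 ≤ n) : √(n : ℝ) = 2 ^ (logb 2 n / 2) := by
  rw [div_eq_mul_one_div, rpow_mul two_pos.le,
    rpow_logb two_pos (by norm_num) (by exact_mod_cast hn), sqrt_eq_rpow]

lemma one_le_of_logb_pos (h : 0 < logb 2 n) : 1 ≤ n :=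
  Nat.one_le_iff_ne_zero.2 fun hn => by simp [hn] at h

lemma logb_two_sq_le_sqrt (h : 16 ≤ logb 2 n) : logb 2 n ^ 2 ≤ √(n : ℝ) := by
  have hlogb : 2 * logb 2 (logb 2 n) ≤ logb 2 n / 2 := by linarith [logb_two_le_div_four h]
  rw [sqrt_natCast_eq_two_rpow (one_le_of_logb_pos (by linarith)),
    ← logb_le_iff_le_rpow one_lt_two (by positivity), logb_pow]
  exact_mod_cast hlogb

lemma four_pow_le_sqrt (hn : 1 ≤ n) (h : 4 * k ≤ logb 2 n) : (4 : ℝ) ^ k ≤ √n := by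
  rw [sqrt_natCast_eq_two_rpow hn, ← logb_le_iff_le_rpow one_lt_two (by positivity), logb_pow,
    show (4 : ℝ) = 2 ^ 2 by norm_num, logb_pow, logb_self_eq_one one_lt_two]
  push_cast
  linarith

lemma one_sub_inv_four_pow_pow_mul_lt_one (hn : 1 ≤ n) (h4 : (4 : ℝ) ^ k ≤ √n)
    (hk : 2 * k * log n < √n) : (1 - 1 / 4 ^ k : ℝ) ^ n * (n : ℝ) ^ (2 * k) < 1 := by
  have hn' : (0 : ℝ) < n := by exact_mod_cast hn
  have h0 : (0 : ℝ) ≤ 1 - 1 / 4 ^ k :=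
    sub_nonneg.2 (div_le_one_of_le₀ (one_le_pow₀ (by norm_num)) (by positivity))
  have hsqrt : √(n : ℝ) ≤ n / 4 ^ k := by
    rw [le_div_iff₀ (by positivity)]
    exact (mul_le_mul_of_nonneg_left h4 (sqrt_nonneg _)).trans_eq (mul_self_sqrt hn'.le)
  calc (1 - 1 / 4 ^ k : ℝ) ^ n * (n : ℝ) ^ (2 * k)
      ≤ exp (-(1 / 4 ^ k)) ^ n * exp (log n) ^ (2 * k) := by
        rw [exp_log hn']
        gcongr
        exact one_sub_le_exp_neg _
    _ = exp (2 * k * log n - n / 4 ^ k) := by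
        rw [← exp_nat_mul, ← exp_nat_mul, ← exp_add]
        push_cast
        ring_nf
    _ < 1 := exp_lt_one_iff.2 (by linarith)

lemma div_pow_le_choose (hkn : k ≤ n) : (n / k : ℝ) ^ k ≤ n.choose k := by
  induction k generalizing n with
  | zero => simp
  | succ k ih =>
    obtain ⟨n, rfl⟩ : ∃ n', n = n' + 1 := ⟨n - 1, by omega⟩
    have hpow : ((n + 1 : ℝ) / (k + 1)) ^ k ≤ (n / k : ℝ) ^ k := by
      rcases k.eq_zero_or_pos with rfl | hk
      · simp
      · gcongr ?_ ^ k
        rw [div_le_div_iff₀ (by positivity) (by positivity)]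
        have : (k : ℝ) ≤ n := by exact_mod_cast Nat.le_of_succ_le_succ hkn
        linarith
    have hchoose : ((n + 1).choose (k + 1) : ℝ) = (n + 1) / (k + 1) * n.choose k := by
      rw [div_mul_eq_mul_div, eq_div_iff (by positivity)]
      exact_mod_cast (Nat.add_one_mul_choose_eq n k).symm
    push_cast
    rw [hchoose, pow_succ']
    gcongr
    exact hpow.trans (ih (by omega))

lemma mul_half_logb_le_logb_choose (hk : 1 ≤ k) (hkn : k ≤ √(n : ℝ)) :
    k * (logb 2 n / 2) ≤ logb 2 (n.choose k) := by
  have hsqrt : √(n : ℝ) ≤ n / k := by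
    rw [le_div_iff₀ (by positivity)]
    exact (mul_le_mul_of_nonneg_left hkn (sqrt_nonneg _)).trans_eq (mul_self_sqrt n.cast_nonneg)
  have hkn' : k ≤ n := by
    exact_mod_cast (hkn.trans hsqrt).trans (div_le_self n.cast_nonneg (by exact_mod_cast hk))
  have hn : 1 ≤ n := hk.trans hkn'
  calc k * (logb 2 n / 2) = logb 2 (√(n : ℝ) ^ k) := by
        rw [sqrt_natCast_eq_two_rpow hn, logb_pow, logb_rpow two_pos (by norm_num)]
    _ ≤ logb 2 (n.choose k) :=
        logb_le_logb_of_le one_lt_two (by positivity)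
          ((pow_le_pow_left₀ (sqrt_nonneg _) hsqrt k).trans (div_pow_le_choose hkn'))

lemma three_halves_le_logb : (3 / 2 : ℝ) ≤ logb 2 3 := by
  have h : logb 2 (2 ^ 3) ≤ logb 2 (3 ^ 2) :=
    logb_le_logb_of_le one_lt_two (by norm_num) (by norm_num)
  rw [logb_pow, logb_pow, logb_self_eq_one one_lt_two] at h
  push_cast at h
  linarith

lemma clog_le_logb_add_one (hn : 1 ≤ n) : (Nat.clog 2 n : ℝ) ≤ logb 2 n + 1 := by
  have hceil : (⌈logb 2 n⌉₊ : ℝ) = Nat.clog 2 n := mod_cast natCeil_logb_natCast 2 n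
  rw [← hceil]
  exact (Nat.ceil_lt_add_one (logb_nonneg one_lt_two (by exact_mod_cast hn))).le

lemma logb_le_clog (n : ℕ) : logb 2 n ≤ Nat.clog 2 n := by
  have hceil : (⌈logb 2 n⌉₊ : ℝ) = Nat.clog 2 n := mod_cast natCeil_logb_natCast 2 n
  exact hceil ▸ Nat.le_ceil _

end Estimates

section Bounds

open Real

variable {k n m : ℕ}

lemma exists_isolatedNeighbours_of_le_logb (hn : 16 ≤ logb 2 n) (hk : 4 * k ≤ logb 2 n) :
    ∃ N : Fin n → Finset (Fin n), IsolatedNeighbours k N := by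
  have hn1 : 1 ≤ n := one_le_of_logb_pos (by linarith)
  have hlog_le : log n ≤ logb 2 n :=
    le_div_self (log_nonneg (by exact_mod_cast hn1)) (log_pos one_lt_two)
      (by linarith [log_two_lt_d9])
  have hlog : 2 * k * log n < √n :=
    calc 2 * k * log n ≤ logb 2 n / 2 * logb 2 n := by gcongr; linarith
      _ < logb 2 n ^ 2 := by nlinarith
      _ ≤ √n := logb_two_sq_le_sqrt hn
  apply exists_isolatedNeighbours
  simpa using one_sub_inv_four_pow_pow_mul_lt_one hn1 (four_pow_le_sqrt hn1 hk) hlog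

lemma two_mul_le_sqrt (hn : 16 ≤ logb 2 n) (hk : 4 * k ≤ logb 2 n) : 2 * k ≤ √(n : ℝ) := by
  nlinarith [logb_two_sq_le_sqrt hn]

lemma two_mul_le (hn : 16 ≤ logb 2 n) (hk : 4 * k ≤ logb 2 n) : 2 * k ≤ n := by
  have hn1 : 1 ≤ n := one_le_of_logb_pos (by linarith)
  have hsqrt : √(n : ℝ) ≤ n := sqrt_le_self_iff.2 (.inr (by exact_mod_cast hn1))
  exact_mod_cast (two_mul_le_sqrt hn hk).trans hsqrt

theorem exists_hazardFreeDepth_eq (hn : 16 ≤ logb 2 n) (hk : 1 ≤ k) (hkn : 4 * k ≤ logb 2 n) :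
    ∃ D : ℕ, hazardFreeDepth (blockComp (setCovering k n) (mux m)) = D ∧
      logb 2 (3 ^ m) + logb 2 (n.choose k) ≤ D := by
  have h2k : 2 * k ≤ n := two_mul_le hn hkn
  obtain ⟨N, hN⟩ := exists_isolatedNeighbours_of_le_logb hn hkn
  obtain ⟨D, hD⟩ := ENat.ne_top_iff_exists.1 (hazardFreeDepth_ne_top
    (exists_blockComp_setCovering_mux_eq (n := n) (m := m) hk (by omega)))
  refine ⟨D, hD.symm, ?_⟩
  have hclog : Nat.clog 2 (n.choose k * 3 ^ m) ≤ D := by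
    exact_mod_cast hD ▸ clog_choose_mul_three_pow_le_hazardFreeDepth (m := m) hk h2k hN
  have hchoose : (n.choose k : ℝ) ≠ 0 := by
    exact_mod_cast (Nat.choose_pos (by omega : k ≤ n)).ne'
  calc logb 2 (3 ^ m) + logb 2 (n.choose k) = logb 2 ((n.choose k * 3 ^ m : ℕ) : ℝ) := by
        push_cast
        rw [logb_mul hchoose (by positivity), add_comm]
    _ ≤ D := (logb_le_clog _).trans (by exact_mod_cast hclog)

lemma mul_add_mul_half_logb_le (hn : 16 ≤ logb 2 n) (hk : 1 ≤ k) (hkn : 4 * k ≤ logb 2 n) :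
    logb 2 3 * m + k * (logb 2 n / 2) ≤ logb 2 (3 ^ m) + logb 2 (n.choose k) := by
  have hsqrt : k ≤ √(n : ℝ) := by linarith [two_mul_le_sqrt hn hkn, k.cast_nonneg (α := ℝ)]
  rw [logb_pow, mul_comm (logb 2 3)]
  gcongr
  exact mul_half_logb_le_logb_choose hk hsqrt

theorem exists_monotoneDepth_eq (hn : 16 ≤ logb 2 n) (hk : 1 ≤ k) (hkn : 4 * k ≤ logb 2 n)
    (hm : 16 * logb 2 n ≤ m) (x : (Fin n × Fin n) × (Fin m ⊕ (Fin m → Bool)) → Bool) :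
    ∃ d : ℕ,
      monotoneDepth (hazardDerivative (blockComp (setCovering k n) (mux m)) x) = d ∧
        d < logb 2 (3 ^ m) + logb 2 (n.choose k) := by
  have h2k : 2 * k ≤ n := two_mul_le hn hkn
  obtain ⟨d, hd, hle⟩ := ENat.le_natCast_iff.1
    (monotoneDepth_hazardDerivative_le hk (by omega : k ≤ n) x)
  refine ⟨d, hd, ?_⟩
  have hm1 : 1 ≤ m := by
    have : (1 : ℝ) ≤ m := by linarith
    exact_mod_cast this
  have hclog_m := clog_le_logb_add_one hm1
  have hlogb_m : logb 2 m ≤ m / 4 := logb_two_le_div_four (by linarith)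
  have hclog_n := clog_le_logb_add_one (n := n) (by omega)
  have hclog_k : (Nat.clog 2 k : ℝ) ≤ Nat.clog 2 n := by
    exact_mod_cast Nat.clog_mono_right 2 (by omega : k ≤ n)
  have hclog_choose := clog_le_logb_add_one (Nat.choose_pos (by omega : k ≤ n))
  have hthree : m * (3 / 2) ≤ logb 2 ((3 : ℝ) ^ m) := by
    rw [logb_pow]
    gcongr
    exact three_halves_le_logb
  calc (d : ℝ) ≤ Nat.clog 2 m + 1 + m + Nat.clog 2 k + Nat.clog 2 n + Nat.clog 2 (n.choose k) := by
        exact_mod_cast hle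
    _ < logb 2 (3 ^ m) + logb 2 (n.choose k) := by linarith

end Bounds

end HazardFree

theorem proposition1p19 :
    ∃ c₀ a C : ℝ, 0 < c₀ ∧ 0 < a ∧ 0 < C ∧
      ∀ c : ℝ, 0 < c → c ≤ c₀ →
      ∀ n k m : ℕ, k = ⌊c * Real.logb 2 (n : ℝ)⌋₊ → 1 ≤ k →
        (∃ D : ℕ,
          HazardFree.hazardFreeDepth
            (HazardFree.blockComp (HazardFree.setCovering k n) (HazardFree.mux m)) = (D : ℕ∞) ∧
          Real.logb 2 ((3 : ℝ) ^ m) + Real.logb 2 (n.choose k : ℝ) ≤ (D : ℝ)) ∧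
        Real.logb 2 3 * (m : ℝ) + a * (c * Real.logb 2 (n : ℝ) ^ 2) ≤
          Real.logb 2 ((3 : ℝ) ^ m) + Real.logb 2 (n.choose k : ℝ) ∧
        (C * Real.logb 2 (n : ℝ) ≤ (m : ℝ) →
          ∀ x : (Fin n × Fin n) × (Fin m ⊕ (Fin m → Bool)) → Bool,
            ∃ d : ℕ,
              HazardFree.monotoneDepth
                (HazardFree.hazardDerivative
                  (HazardFree.blockComp (HazardFree.setCovering k n) (HazardFree.mux m)) x) =
                (d : ℕ∞) ∧
              (d : ℝ) < Real.logb 2 ((3 : ℝ) ^ m) + Real.logb 2 (n.choose k : ℝ)) := by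
  refine ⟨1 / 16, 1 / 4, 16, by norm_num, by norm_num, by norm_num, fun c hc hc₀ n k m hk hk1 => ?_⟩
  have hcn : 1 ≤ c * Real.logb 2 n := Nat.one_le_floor_iff _ |>.1 (hk ▸ hk1)
  have hk_le : k ≤ c * Real.logb 2 n := hk ▸ Nat.floor_le (by linarith)
  have hk_gt : c * Real.logb 2 n / 2 < k := hk ▸ Nat.div_two_lt_floor hcn
  have hlogb_pos : 0 < Real.logb 2 n := pos_of_mul_pos_right (by linarith) hc.le
  have hc_le : c * Real.logb 2 n ≤ 1 / 16 * Real.logb 2 n := by gcongr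
  have hn : 16 ≤ Real.logb 2 n := by linarith
  have hkn : 4 * k ≤ Real.logb 2 n := by linarith
  refine ⟨HazardFree.exists_hazardFreeDepth_eq hn hk1 hkn, ?_, fun hm x =>
    HazardFree.exists_monotoneDepth_eq hn hk1 hkn hm x⟩
  have hbound := HazardFree.mul_add_mul_half_logb_le (m := m) hn hk1 hkn
  nlinarith
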